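/- There exists a family $(I_t)_{t\in T}$ of segments, each of the form $I_t=\operatorname{conv}\{(0,a_t),(1,b_t)\}$ and contained in the unit square $[0,1]\times[0,1]\subset\mathbb{R}^2$ (that is, $a_t,b_t\in[0,1]$), such that $$\bigcup_{t\in T} I_t\supset \{0\}\times[0,1]\qquad\text{and}\qquad \lambda^2\Bigl(\bigcup_{t\in T} I_t\Bigr)=0,$$ where $\lambda^2$ denotes two-dimensional Lebesgue measure. -/

import Mathlib

/-- The closed unit square `[0,1] × [0,1]` in the plane. -/
def unitSquare : Set (ℝ × ℝ) := Set.Icc (0 : ℝ) 1 ×ˢ Set.Icc (0 : ℝ) 1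

/-- A crossing segment: a set of the form `conv {(0, a), (1, b)}`, with real `a` and `b`,
that is contained in the unit square. -/
def IsCrossingSegment (J : Set (ℝ × ℝ)) : Prop :=
  (∃ a b : ℝ, J = convexHull ℝ {((0 : ℝ), a), ((1 : ℝ), b)}) ∧ J ⊆ unitSquare

open MeasureTheory Filter Topology

/-! Join `(0, a)` to `(1, f a)`, where `f` is `sawtooth` for a sequence `c` and grids of size `N n`.
On each cell of grid `n`, `f` has slope `-c n` up to an error `2⁻ⁿ / N n` (`abs_sawtooth_sub_le`).
At abscissa `x`, the segments from one cell therefore spread over a width about `|(1 - x) - x * c n|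
/ N n`, and all cells together cover measure at most `4 (|(1 - x) - x * c n| + 2⁻ⁿ)`. If `c` returns
near every real, then for each `x ≠ 0` some late `c n` is near `(1 - x) / x`, so the vertical
section is null; Fubini concludes. -/

/-- The largest multiple of `1 / N` that is at most `a` (for `a ≥ 0`). -/
noncomputable def gridFloor (N : ℕ) (a : ℝ) : ℝ := (⌊a * N⌋₊ : ℝ) / N

theorem gridFloor_nonneg (N : ℕ) (a : ℝ) : 0 ≤ gridFloor N a := by
  unfold gridFloor; positivity

theorem gridFloor_le {N : ℕ} (hN : 0 < N) {a : ℝ} (ha : 0 ≤ a) : gridFloor N a ≤ a := by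
  unfold gridFloor
  rw [div_le_iff₀ (by positivity)]
  exact Nat.floor_le (by positivity)

theorem sub_gridFloor_le {N : ℕ} (hN : 0 < N) (a : ℝ) : a - gridFloor N a ≤ 1 / N := by
  have h := (Nat.lt_floor_add_one (a * N)).le
  have hN' : (0 : ℝ) < N := by exact_mod_cast hN
  unfold gridFloor
  rw [sub_le_iff_le_add, ← add_div, le_div_iff₀ hN']
  linarith

theorem gridFloor_gridFloor_of_dvd {M N : ℕ} (hM : 0 < M) (hN : 0 < N) (h : M ∣ N) (a : ℝ) :
    gridFloor M (gridFloor N a) = gridFloor M a := by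
  obtain ⟨k, rfl⟩ := h
  have hk : 0 < k := Nat.pos_of_mul_pos_left hN
  have hM' : (M : ℝ) ≠ 0 := by positivity
  have hk' : (k : ℝ) ≠ 0 := by positivity
  have h1 : a * M = a * ((M * k : ℕ) : ℝ) / k := by push_cast; field_simp
  have h2 : gridFloor (M * k) a * M = (⌊a * ((M * k : ℕ) : ℝ)⌋₊ : ℝ) / k := by
    unfold gridFloor; push_cast; field_simp
  rw [gridFloor, h2, gridFloor, h1, Nat.floor_div_natCast, Nat.floor_div_natCast, Nat.floor_natCast]

theorem gridFloor_gridFloor_of_dvd' {M N : ℕ} (hM : 0 < M) (hN : 0 < N) (h : M ∣ N) (a : ℝ) :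
    gridFloor N (gridFloor M a) = gridFloor M a := by
  obtain ⟨k, rfl⟩ := h
  have hk : 0 < k := Nat.pos_of_mul_pos_left hN
  have hM' : (M : ℝ) ≠ 0 := by positivity
  have hk' : (k : ℝ) ≠ 0 := by positivity
  have h2 : gridFloor M a * ((M * k : ℕ) : ℝ) = ((⌊a * M⌋₊ * k : ℕ) : ℝ) := by
    unfold gridFloor; push_cast; field_simp
  rw [gridFloor, h2, Nat.floor_natCast, gridFloor]
  push_cast
  field_simp

theorem abs_gridFloor_sub_gridFloor_le {M N : ℕ} (hM : 0 < M) (hN : 0 < N) (h : M ∣ N) {a : ℝ}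
    (ha : 0 ≤ a) : |gridFloor N a - gridFloor M a| ≤ 1 / M := by
  have h1 : gridFloor M a ≤ gridFloor N a := by
    rw [← gridFloor_gridFloor_of_dvd hM hN h]
    exact gridFloor_le hM (gridFloor_nonneg _ _)
  rw [abs_of_nonneg (by linarith)]
  linarith [gridFloor_le hN ha, sub_gridFloor_le hM a]

/-! ### Rapidly refining grids -/

/-- Grid sizes, each dividing the next, that grow fast compared with the sequence `c`. -/
noncomputable def gridSize (c : ℕ → ℝ) : ℕ → ℕ
  | 0 => 4 * (⌈|c 0|⌉₊ + 1)
  | n + 1 => gridSize c n * (2 ^ (n + 3) * (⌈|c n|⌉₊ + ⌈|c (n + 1)|⌉₊ + 1))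

theorem gridSize_pos (c : ℕ → ℝ) (n : ℕ) : 0 < gridSize c n := by
  induction n with
  | zero => simp [gridSize]
  | succ n ih => rw [gridSize]; positivity

theorem gridSize_dvd_succ (c : ℕ → ℝ) (n : ℕ) : gridSize c n ∣ gridSize c (n + 1) :=
  Dvd.intro _ rfl

theorem gridSize_dvd (c : ℕ → ℝ) {m n : ℕ} (h : m ≤ n) : gridSize c m ∣ gridSize c n := by
  induction n, h using Nat.le_induction with
  | base => exact dvd_rfl
  | succ n _ ih => exact ih.trans (gridSize_dvd_succ c n)

/-- Grid `n + 1` absorbs both the rounding error weighted by `c n` and the next term, weighted by `c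
(n + 1)`. -/
theorem abs_add_abs_div_gridSize_succ_le (c : ℕ → ℝ) (n : ℕ) :
    (|c n| + |c (n + 1)|) / gridSize c (n + 1) ≤ (1 / 2) ^ (n + 3) / gridSize c n := by
  have h0 : (0 : ℝ) < gridSize c n := by exact_mod_cast gridSize_pos c n
  have h1 := Nat.le_ceil |c n|
  have h2 := Nat.le_ceil |c (n + 1)|
  rw [gridSize]
  push_cast
  rw [div_le_div_iff₀ (by positivity) h0, one_div, inv_pow]
  have : ((2 : ℝ) ^ (n + 3))⁻¹ * (gridSize c n * (2 ^ (n + 3) *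
      (⌈|c n|⌉₊ + ⌈|c (n + 1)|⌉₊ + 1))) =
      (⌈|c n|⌉₊ + ⌈|c (n + 1)|⌉₊ + 1) * gridSize c n := by field_simp
  rw [this]
  exact mul_le_mul_of_nonneg_right (by linarith) h0.le

theorem abs_div_gridSize_le_of_lt (c : ℕ → ℝ) {m n : ℕ} (h : n < m) :
    |c m| / gridSize c m ≤ (1 / 2) ^ (m + 2) / gridSize c n := by
  obtain ⟨k, rfl⟩ : ∃ k, m = k + 1 := ⟨m - 1, by omega⟩
  have h0 : (0 : ℝ) < gridSize c n := by exact_mod_cast gridSize_pos c n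
  have h1 : (gridSize c n : ℝ) ≤ gridSize c k := by
    exact_mod_cast Nat.le_of_dvd (gridSize_pos c k) (gridSize_dvd c (by omega))
  calc |c (k + 1)| / gridSize c (k + 1) ≤ (|c k| + |c (k + 1)|) / gridSize c (k + 1) := by
        gcongr; linarith [abs_nonneg (c k)]
    _ ≤ (1 / 2) ^ (k + 3) / gridSize c k := abs_add_abs_div_gridSize_succ_le c k
    _ ≤ (1 / 2) ^ (k + 1 + 2) / gridSize c n := by gcongr

theorem abs_div_gridSize_le (c : ℕ → ℝ) (m : ℕ) :
    |c m| / gridSize c m ≤ (1 / 2) ^ (m + 2) := by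
  cases m with
  | zero =>
    have h1 := Nat.le_ceil |c 0|
    rw [gridSize, div_le_iff₀ (by positivity)]
    push_cast
    norm_num
    linarith
  | succ k =>
    refine (abs_div_gridSize_le_of_lt c (Nat.succ_pos k)).trans (div_le_self (by positivity) ?_)
    exact_mod_cast gridSize_pos c 0

/-- A function that, on the cells of the grid of size `gridSize c n`, is nearly affine of
slope `- c n`. -/
noncomputable def sawtooth (c : ℕ → ℝ) (a : ℝ) : ℝ :=
  1 / 2 - ∑' m, c m * (gridFloor (gridSize c (m + 1)) a - gridFloor (gridSize c m) a)

theorem abs_sawtooth_term_le (c : ℕ → ℝ) {a : ℝ} (ha : 0 ≤ a) (m : ℕ) :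
    |c m * (gridFloor (gridSize c (m + 1)) a - gridFloor (gridSize c m) a)| ≤
      |c m| / gridSize c m := by
  rw [abs_mul, div_eq_mul_one_div]
  exact mul_le_mul_of_nonneg_left (abs_gridFloor_sub_gridFloor_le (gridSize_pos c m)
    (gridSize_pos c _) (gridSize_dvd_succ c m) ha) (abs_nonneg _)

theorem hasSum_half_pow_add (k : ℕ) :
    HasSum (fun m : ℕ => (1 / 2 : ℝ) ^ (m + (k + 1))) ((1 / 2) ^ k) := by
  have h := hasSum_geometric_two.mul_right ((1 / 2 : ℝ) ^ (k + 1))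
  have h2 : 2 * (1 / 2 : ℝ) ^ (k + 1) = (1 / 2) ^ k := by rw [pow_succ]; ring
  rw [h2] at h
  simpa only [pow_add _ _ (k + 1)] using h

theorem summable_sawtooth (c : ℕ → ℝ) {a : ℝ} (ha : 0 ≤ a) :
    Summable fun m => c m * (gridFloor (gridSize c (m + 1)) a - gridFloor (gridSize c m) a) :=
  Summable.of_norm_bounded (hasSum_half_pow_add 1).summable fun m => by
    rw [Real.norm_eq_abs]
    exact (abs_sawtooth_term_le c ha m).trans (abs_div_gridSize_le c m)

theorem sawtooth_mem_Icc (c : ℕ → ℝ) {a : ℝ} (ha : 0 ≤ a) : sawtooth c a ∈ Set.Icc (0 : ℝ) 1 := by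
  -- The bounds `(1 / 2) ^ (m + 2)` sum to `1 / 2`, the distance from the centre `1 / 2` to either
  -- endpoint.
  have h : |∑' m, c m * (gridFloor (gridSize c (m + 1)) a - gridFloor (gridSize c m) a)| ≤
      (1 / 2) ^ 1 := by
    rw [← Real.norm_eq_abs]
    refine tsum_of_norm_bounded (hasSum_half_pow_add 1) fun m => ?_
    exact (abs_sawtooth_term_le c ha m).trans (abs_div_gridSize_le c m)
  rw [abs_le] at h
  unfold sawtooth
  constructor <;> linarith [h.1, h.2]

/-- Terms below `n` agree at `a` and its grid point, where all later terms vanish. At `a`, term `n`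
supplies the slope up to rounding, and fast grid growth makes the tail negligible. -/
theorem abs_sawtooth_sub_le (c : ℕ → ℝ) {a : ℝ} (ha : 0 ≤ a) (n : ℕ) :
    |sawtooth c a - sawtooth c (gridFloor (gridSize c n) a) +
      c n * (a - gridFloor (gridSize c n) a)| ≤ (1 / 2) ^ n / gridSize c n := by
  set b := gridFloor (gridSize c n) a with hb
  have hN : (0 : ℝ) < gridSize c n := by exact_mod_cast gridSize_pos c n
  have hlow : ∀ m ≤ n, gridFloor (gridSize c m) b = gridFloor (gridSize c m) a := fun m hm =>
    gridFloor_gridFloor_of_dvd (gridSize_pos c m) (gridSize_pos c n) (gridSize_dvd c hm) a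
  have hhigh : ∀ m, n ≤ m → gridFloor (gridSize c m) b = b := fun m hm =>
    gridFloor_gridFloor_of_dvd' (gridSize_pos c n) (gridSize_pos c m) (gridSize_dvd c hm) a
  have hsb : ∑' m, c m * (gridFloor (gridSize c (m + 1)) b - gridFloor (gridSize c m) b) =
      ∑ m ∈ Finset.range n,
        c m * (gridFloor (gridSize c (m + 1)) a - gridFloor (gridSize c m) a) := by
    rw [tsum_eq_sum (s := Finset.range n)]
    · refine Finset.sum_congr rfl fun m hm => ?_
      have := Finset.mem_range.1 hm
      rw [hlow m (by omega), hlow (m + 1) (by omega)]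
    · intro m hm
      rw [Finset.mem_range, not_lt] at hm
      rw [hhigh m hm, hhigh (m + 1) (by omega), sub_self, mul_zero]
  have hsa := (summable_sawtooth c ha).sum_add_tsum_nat_add (n + 1)
  rw [Finset.sum_range_succ] at hsa
  have htail : ‖∑' i, c (i + (n + 1)) * (gridFloor (gridSize c (i + (n + 1) + 1)) a -
      gridFloor (gridSize c (i + (n + 1))) a)‖ ≤ (1 / 2) ^ (n + 2) / gridSize c n := by
    refine tsum_of_norm_bounded ((hasSum_half_pow_add (n + 2)).div_const _) fun m => ?_
    exact (abs_sawtooth_term_le c ha _).trans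
      (abs_div_gridSize_le_of_lt c (show n < m + (n + 1) by omega))
  rw [Real.norm_eq_abs] at htail
  have hhead : |c n * (a - gridFloor (gridSize c (n + 1)) a)| ≤
      (1 / 2) ^ (n + 3) / gridSize c n := by
    refine le_trans ?_ (abs_add_abs_div_gridSize_succ_le c n)
    rw [abs_mul, abs_of_nonneg (sub_nonneg.2 (gridFloor_le (gridSize_pos c _) ha))]
    calc |c n| * (a - gridFloor (gridSize c (n + 1)) a) ≤ |c n| * (1 / gridSize c (n + 1)) := by
          gcongr; exact sub_gridFloor_le (gridSize_pos c _) a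
      _ ≤ (|c n| + |c (n + 1)|) / gridSize c (n + 1) := by
          rw [← div_eq_mul_one_div]; gcongr; linarith [abs_nonneg (c (n + 1))]
  have key : sawtooth c a - sawtooth c b + c n * (a - b) =
      c n * (a - gridFloor (gridSize c (n + 1)) a) -
      ∑' i, c (i + (n + 1)) * (gridFloor (gridSize c (i + (n + 1) + 1)) a -
        gridFloor (gridSize c (i + (n + 1))) a) := by
    rw [sawtooth, sawtooth, hsb, ← hsa]
    ring
  rw [key]
  refine (abs_sub _ _).trans ((add_le_add hhead htail).trans ?_)
  rw [← add_div]
  gcongr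
  have : (0 : ℝ) < (1 / 2) ^ n := by positivity
  rw [pow_add, pow_add]
  linarith

/-- A sequence that comes close to every real number infinitely often. -/
noncomputable def recurrentSeq (n : ℕ) : ℝ := TopologicalSpace.denseSeq ℝ n.unpair.1

/-- The second unpaired coordinate is free, so each dense value recurs at arbitrarily late indices.
-/
theorem exists_recurrentSeq_near (y : ℝ) {ε : ℝ} (hε : 0 < ε) (m : ℕ) :
    ∃ n ≥ m, |recurrentSeq n - y| < ε := by
  obtain ⟨k, hk⟩ := (TopologicalSpace.denseRange_denseSeq ℝ).exists_dist_lt y hε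
  refine ⟨Nat.pair k m, Nat.right_le_pair k m, ?_⟩
  rw [recurrentSeq, Nat.unpair_pair, ← Real.dist_eq, dist_comm]
  exact hk

/-! ### Strip covers and null sections -/

/-- The half-width of the strips that cover the segments at stage `n`. -/
noncomputable def stripWidth (c : ℕ → ℝ) (n : ℕ) (x : ℝ) : ℝ :=
  (|(1 - x) - x * c n| + (1 / 2) ^ n) / gridSize c n

/-- The union of the strips around the segments that start at the points of the grid of
size `gridSize c n`. -/
def stripCover (c : ℕ → ℝ) (n : ℕ) : Set (ℝ × ℝ) :=
  ⋃ j ∈ Finset.range (gridSize c n + 1), {p | p.1 ∈ Set.Icc (0 : ℝ) 1 ∧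
    |p.2 - ((1 - p.1) * (j / gridSize c n) + p.1 * sawtooth c (j / gridSize c n))| ≤
      stripWidth c n p.1}

theorem measurableSet_stripCover (c : ℕ → ℝ) (n : ℕ) : MeasurableSet (stripCover c n) := by
  refine Finset.measurableSet_biUnion _ fun j _ => IsClosed.measurableSet ?_
  refine (isClosed_Icc.preimage continuous_fst).and (isClosed_le (by fun_prop) ?_)
  unfold stripWidth
  fun_prop

theorem mem_stripCover (c : ℕ → ℝ) (n : ℕ) {a x : ℝ} (ha : a ∈ Set.Icc (0 : ℝ) 1)
    (hx : x ∈ Set.Icc (0 : ℝ) 1) : (x, (1 - x) * a + x * sawtooth c a) ∈ stripCover c n := by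
  have hN := gridSize_pos c n
  have hN' : (0 : ℝ) < gridSize c n := by exact_mod_cast hN
  simp only [stripCover, Set.mem_iUnion, Set.mem_ofPred_eq]
  refine ⟨⌊a * gridSize c n⌋₊, ?_, hx, ?_⟩
  -- Index `gridSize c n` itself occurs, at `a = 1`.
  · rw [Finset.mem_range, Nat.lt_succ_iff]
    apply Nat.floor_le_of_le
    nlinarith [ha.2]
  change |(1 - x) * a + x * sawtooth c a - ((1 - x) * gridFloor (gridSize c n) a +
    x * sawtooth c (gridFloor (gridSize c n) a))| ≤ _
  have h1 := abs_sawtooth_sub_le c ha.1 n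
  have h2 := sub_gridFloor_le hN a
  have h3 := gridFloor_le hN ha.1
  set b := gridFloor (gridSize c n) a
  have : (1 - x) * a + x * sawtooth c a - ((1 - x) * b + x * sawtooth c b) =
      ((1 - x) - x * c n) * (a - b) + x * (sawtooth c a - sawtooth c b + c n * (a - b)) := by ring
  rw [this, stripWidth, add_div]
  refine (abs_add_le _ _).trans (add_le_add ?_ ?_)
  · rw [abs_mul, abs_of_nonneg (sub_nonneg.2 h3), div_eq_mul_one_div]
    gcongr
  · rw [abs_mul, abs_of_nonneg hx.1]
    exact (mul_le_of_le_one_left (abs_nonneg _) hx.2).trans h1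

theorem volume_section_stripCover_le (c : ℕ → ℝ) (n : ℕ) (x : ℝ) :
    volume (Prod.mk x ⁻¹' stripCover c n) ≤
      ENNReal.ofReal (4 * (|(1 - x) - x * c n| + (1 / 2) ^ n)) := by
  have hN : (1 : ℝ) ≤ gridSize c n := by exact_mod_cast gridSize_pos c n
  have hw : 0 ≤ stripWidth c n x := by unfold stripWidth; positivity
  calc volume (Prod.mk x ⁻¹' stripCover c n)
      ≤ volume (⋃ j ∈ Finset.range (gridSize c n + 1), Metric.closedBall
          ((1 - x) * ((j : ℝ) / gridSize c n) + x * sawtooth c (j / gridSize c n))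
          (stripWidth c n x)) := by
        refine measure_mono fun y hy => ?_
        simp only [stripCover, Set.mem_preimage, Set.mem_iUnion, Set.mem_ofPred_eq] at hy ⊢
        obtain ⟨j, hj, -, h⟩ := hy
        exact ⟨j, hj, by rwa [Metric.mem_closedBall, Real.dist_eq]⟩
    _ ≤ ∑ _j ∈ Finset.range (gridSize c n + 1), ENNReal.ofReal (2 * stripWidth c n x) := by
        refine (measure_biUnion_finset_le _ _).trans (Finset.sum_le_sum fun j _ => ?_)
        rw [Real.volume_closedBall]
    _ = ENNReal.ofReal ((gridSize c n + 1 : ℕ) * (2 * stripWidth c n x)) := by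
        rw [Finset.sum_const, Finset.card_range, nsmul_eq_mul,
          ENNReal.ofReal_mul (Nat.cast_nonneg _), ENNReal.ofReal_natCast]
    _ ≤ ENNReal.ofReal (4 * (|(1 - x) - x * c n| + (1 / 2) ^ n)) := by
        apply ENNReal.ofReal_le_ofReal
        have : |(1 - x) - x * c n| + (1 / 2) ^ n = gridSize c n * stripWidth c n x := by
          unfold stripWidth; field_simp
        rw [this]
        push_cast
        -- Uses `N + 1 ≤ 2 * N`, whence the factor 4.
        nlinarith

theorem volume_iInter_stripCover : volume (⋂ n, stripCover recurrentSeq n) = 0 := by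
  rw [Measure.volume_eq_prod, Measure.measure_prod_null
    (MeasurableSet.iInter fun n => measurableSet_stripCover _ n)]
  have h0 : ∀ᵐ x : ℝ, x ≠ 0 := by simp [ae_iff]
  filter_upwards [h0] with x hx0
  change volume _ = 0
  refine le_antisymm (ENNReal.le_of_forall_pos_le_add fun ε hε _ => ?_) zero_le
  have hε' : (0 : ℝ) < ε := hε
  -- Two errors below `ε / 8`, times 4, give `ε`.
  obtain ⟨m, hm⟩ := exists_pow_lt_of_lt_one (show (0 : ℝ) < ε / 8 by positivity)
    (show (1 / 2 : ℝ) < 1 by norm_num)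
  obtain ⟨n, hn, hc⟩ := exists_recurrentSeq_near ((1 - x) / x)
    (show 0 < (ε : ℝ) / 8 / |x| by positivity) m
  have h1 : |(1 - x) - x * recurrentSeq n| < ε / 8 := by
    have : (1 - x) - x * recurrentSeq n = -(x * (recurrentSeq n - (1 - x) / x)) := by
      field_simp; ring
    rw [this, abs_neg, abs_mul, mul_comm]
    exact (lt_div_iff₀ (abs_pos.2 hx0)).1 hc
  have h2 : (1 / 2 : ℝ) ^ n ≤ (1 / 2) ^ m :=
    pow_le_pow_of_le_one (by norm_num) (by norm_num) hn
  rw [zero_add]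
  calc volume (Prod.mk x ⁻¹' ⋂ n, stripCover recurrentSeq n)
      ≤ volume (Prod.mk x ⁻¹' stripCover recurrentSeq n) :=
        measure_mono (Set.preimage_mono (Set.iInter_subset _ n))
    _ ≤ _ := volume_section_stripCover_le _ n x
    _ ≤ ENNReal.ofReal ε := ENNReal.ofReal_le_ofReal (by linarith)
    _ = ε := ENNReal.ofReal_coe_nnreal

theorem isCrossingSegment_convexHull {a b : ℝ} (ha : a ∈ Set.Icc (0 : ℝ) 1)
    (hb : b ∈ Set.Icc (0 : ℝ) 1) :
    IsCrossingSegment (convexHull ℝ {((0 : ℝ), a), ((1 : ℝ), b)}) := by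
  refine ⟨⟨a, b, rfl⟩, convexHull_min ?_ ((convex_Icc 0 1).prod (convex_Icc 0 1))⟩
  rintro p (rfl | rfl)
  · exact ⟨by simp, ha⟩
  · exact ⟨by simp, hb⟩

theorem theorem1 :
    ∃ (T : Type) (I : T → Set (ℝ × ℝ)),
      (∀ t : T, IsCrossingSegment (I t)) ∧
      ({(0 : ℝ)} ×ˢ Set.Icc (0 : ℝ) 1 ⊆ ⋃ t : T, I t) ∧
      MeasureTheory.volume (⋃ t : T, I t) = 0 := by
  refine ⟨Set.Icc (0 : ℝ) 1,
    fun a => convexHull ℝ {((0 : ℝ), (a : ℝ)), ((1 : ℝ), sawtooth recurrentSeq a)},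
    fun a => isCrossingSegment_convexHull a.2 (sawtooth_mem_Icc _ a.2.1), ?_, ?_⟩
  · rintro ⟨x, y⟩ ⟨hx, hy⟩
    obtain rfl : x = 0 := hx
    exact Set.mem_iUnion.2 ⟨⟨y, hy⟩, subset_convexHull ℝ _ (Set.mem_insert _ _)⟩
  · refine measure_mono_null (Set.iUnion_subset fun a => ?_) volume_iInter_stripCover
    rw [convexHull_pair]
    rintro p ⟨u, v, hu, hv, huv, rfl⟩
    obtain rfl : u = 1 - v := by linarith
    refine Set.mem_iInter.2 fun n => ?_
    convert mem_stripCover recurrentSeq n a.2 (show v ∈ Set.Icc (0 : ℝ) 1 from ⟨hv, by linarith⟩)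
      using 1
    simp
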